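/- Let $\Bbbk$ be an algebraically closed field of characteristic zero, and let $(V,c)$ be a braided vector space of diagonal type with basis $x_1,x_2$, braiding $c(x_i\otimes x_j)=q_{ij}\,x_j\otimes x_i$, where $q_{ij}\in\Bbbk^\times$ and $q_{ii}\neq 1$ for $i,j\in\{1,2\}$. Let $\mathcal B(V)=T(V)/\mathcal J(V)$ be its Nichols algebra, where $\mathcal J(V)$ is the largest homogeneous two-sided ideal and coideal of the braided Hopf algebra $T(V)$ contained in $\bigoplus_{m\ge 2}T^m(V)$. Put $\tilde q_{12}=q_{12}q_{21}$, $(m)_a=\sum_{j=0}^{m-1}a^j$, $y_m=(\mathrm{ad}_c\,x_1)^m(x_2)\in\mathcal B(V)$ with $(\mathrm{ad}_c\, x_1)(z)=x_1z-\mathrm{mult}(c(x_1\otimes z))$, and $p_m=q_{11}^{m^2}q_{12}^mq_{21}^mq_{22}$ for $m\ge 0$. Fix $n\ge 1$ and assume that $q:=p_n$ is a primitive $N$-th root of unity for some $N\ge 2$. For $1\le t\le N-1$ let $$d_t=1-q^{t+1}q_{11}^{2n}\tilde q_{12}+\frac{q^t(1-q_{11}^n\tilde q_{12})\,(n+1)_{q_{11}}}{(t)_q}.$$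 If $y_n^N=0$ and $y_{n+1}\neq 0$ in $\mathcal B(V)$, then $d_t=0$ for some $t$ with $1\le t\le N-2$. (In particular the hypotheses cannot hold together when $N=2$.) -/

import Mathlib

open scoped TensorProduct

noncomputable section

namespace NicholsDiag

/-! ### Quantum integers -/

/-- `(n)_a = 1 + a + ... + a^(n-1)`. -/
def qInt {k : Type*} [Field k] (a : k) (n : ℕ) : k :=
  ∑ j ∈ Finset.range n, a ^ j

/-! ### The tensor algebra of a braided vector space of diagonal type

`V` has basis `(x_i)_{i ∈ ι}` and braiding `c (x_i ⊗ x_j) = q i j • x_j ⊗ x_i`.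
Its tensor algebra is the free algebra on the `x_i`. -/

section Tensor

variable {k : Type*} [Field k] {ι : Type*}

/-- The component of degree `n` of `T(V)`, spanned by the words of length `n` in the `x_i`. -/
def degreePart (k : Type*) [Field k] (ι : Type*) (n : ℕ) : Submodule k (FreeAlgebra k ι) :=
  Submodule.span k (Set.range (FreeAlgebra.ι k)) ^ n

/-- The action of the group-like element `α_i` on `T(V)`: the algebra endomorphism with
`α_i · x_j = q i j • x_j`. For every `z` in `T(V)` one has `c (x_i ⊗ z) = (α_i · z) ⊗ x_i`. -/
def act (q : ι → ι → k) (i : ι) : FreeAlgebra k ι →ₐ[k] FreeAlgebra k ι :=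
  FreeAlgebra.lift k fun j => q i j • FreeAlgebra.ι k j

/-- Left multiplication by `x_i ⊗ 1 + 1 ⊗ x_i` in the braided tensor product algebra
`T(V) ⊗ T(V)`, that is, `a ⊗ b ↦ x_i a ⊗ b + (α_i · a) ⊗ x_i b`. -/
def mulPrimitive (q : ι → ι → k) (i : ι) :
    Module.End k (FreeAlgebra k ι ⊗[k] FreeAlgebra k ι) :=
  TensorProduct.map (LinearMap.mulLeft k (FreeAlgebra.ι k i)) LinearMap.id +
    TensorProduct.map (act q i).toLinearMap (LinearMap.mulLeft k (FreeAlgebra.ι k i))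

/-- The coproduct of the braided Hopf algebra `T(V)`: the algebra morphism from `T(V)` to the
braided tensor product algebra `T(V) ⊗ T(V)` with `x_i ↦ x_i ⊗ 1 + 1 ⊗ x_i`. -/
def comul (q : ι → ι → k) : FreeAlgebra k ι →ₗ[k] FreeAlgebra k ι ⊗[k] FreeAlgebra k ι :=
  (LinearMap.applyₗ ((1 : FreeAlgebra k ι) ⊗ₜ[k] (1 : FreeAlgebra k ι))).comp
    (FreeAlgebra.lift k (mulPrimitive q)).toLinearMap

/-- A two-sided ideal of `T(V)`, as a subspace. -/
def toSubspace (I : TwoSidedIdeal (FreeAlgebra k ι)) : Submodule k (FreeAlgebra k ι) :=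
  (TwoSidedIdeal.asIdeal I).restrictScalars k

/-- `I` is a homogeneous ideal of `T(V)` living in degrees `≥ 2`, and a coideal:
`Δ(I) ⊆ I ⊗ T(V) + T(V) ⊗ I`. -/
structure IsGradedCoideal (q : ι → ι → k) (I : TwoSidedIdeal (FreeAlgebra k ι)) : Prop where
  homogeneous : toSubspace I = ⨆ n ∈ Set.Ici 2, toSubspace I ⊓ degreePart k ι n
  coideal : ∀ x ∈ I, comul q x ∈
    LinearMap.range (TensorProduct.map (toSubspace I).subtype
        (LinearMap.id : FreeAlgebra k ι →ₗ[k] FreeAlgebra k ι)) ⊔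
      LinearMap.range (TensorProduct.map
        (LinearMap.id : FreeAlgebra k ι →ₗ[k] FreeAlgebra k ι) (toSubspace I).subtype)

/-- The defining ideal `J(V)` of the Nichols algebra: the sum of all homogeneous two-sided ideals
of `T(V)` in degrees `≥ 2` that are coideals. -/
def nicholsIdeal (q : ι → ι → k) : TwoSidedIdeal (FreeAlgebra k ι) :=
  sSup {I | IsGradedCoideal q I}

/-- The Nichols algebra `B(V) = T(V) / J(V)`. -/
abbrev NicholsAlgebra (q : ι → ι → k) : Type _ :=
  (nicholsIdeal q).ringCon.Quotient

/-- The projection `T(V) → B(V)`. -/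
def proj (q : ι → ι → k) : FreeAlgebra k ι →+* NicholsAlgebra q :=
  (nicholsIdeal q).ringCon.mk'

/-- The braided adjoint action of `x_i`:
`(ad_c x_i)(z) = x_i z - mult (c (x_i ⊗ z)) = x_i z - (α_i · z) x_i`. -/
def adc (q : ι → ι → k) (i : ι) : Module.End k (FreeAlgebra k ι) :=
  LinearMap.mulLeft k (FreeAlgebra.ι k i) -
    (LinearMap.mulRight k (FreeAlgebra.ι k i)).comp (act q i).toLinearMap

end Tensor

/-! ### Rank two; the indices `1`, `2` are the elements `0`, `1` of `Fin 2` -/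

section RankTwo

variable {k : Type*} [Field k]

/-- `y_m = (ad_c x_1)^m x_2` in `B(V)`. (The projection from `T(V)` to `B(V)` is a morphism of
braided Hopf algebras, so it commutes with the braided adjoint action.) -/
def y (q : Fin 2 → Fin 2 → k) (m : ℕ) : NicholsAlgebra q :=
  proj q ((adc q 0 ^ m) (FreeAlgebra.ι k 1))

/-- `p_m = q_{β_m, β_m} = q_11^(m^2) q_12^m q_21^m q_22`, where `β_m = m α_1 + α_2`. -/
def p (q : Fin 2 → Fin 2 → k) (m : ℕ) : k :=
  q 0 0 ^ (m ^ 2) * q 0 1 ^ m * q 1 0 ^ m * q 1 1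

/-- With `a = p_n`, the scalar
`d_t = 1 - a^(t+1) q_11^(2n) q_12 q_21 + a^t (1 - q_11^n q_12 q_21) (n+1)_{q_11} / (t)_a`. -/
def d (q : Fin 2 → Fin 2 → k) (n t : ℕ) : k :=
  1 - p q n ^ (t + 1) * q 0 0 ^ (2 * n) * (q 0 1 * q 1 0) +
    p q n ^ t * (1 - q 0 0 ^ n * (q 0 1 * q 1 0)) * qInt (q 0 0) (n + 1) / qInt (p q n) t

end RankTwo

end NicholsDiag

end

/-!
The argument takes place in the tensor algebra `T(V)`. Write `a = q_11`, `s = q_12 q_21`, `Q = p_n`,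
`χ = a^n q_12`, and let `u`, `v` be the lifts `liftY q n`, `liftY q (n + 1)` of `y_n`, `y_{n+1}`.
Let `J` be the defining ideal of the Nichols algebra. In the comments `x_1`, `x_2` and the
derivations `∂_1`, `∂_2` below have the indices `0`, `1 : Fin 2`.

The maps `∂_i = (id ⊗ x_i^*) Δ` are skew derivations of `T(V)` that preserve `J`
(`skewDer_mem_nicholsIdeal`). The map `∂_1` kills all the `y_m`, and `∂_2` maps `y_m` to a multiple
of `x_1^m`. Hence `D = ∂_1^n ∂_2` (`topDer`) is a skew derivation on the kernel of `∂_1`, with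
`D u = γ` and `D v = γ b x_1`, where `b = (1 - a^n s) (n+1)_a` and
`γ = ∏_{l < n} (1 - a^l s) (l+1)_a`.

Since `u^N ∈ J` and `x_1 u = χ u x_1 + v`, the ideal `J` contains
`W_0 = x_1 u^N - χ^N u^N x_1 = ∑_{i + j = N - 1} χ^i u^i v u^j`. Put
`W_r = ∑_{i + j = N - 1 - r} binom(r + j, r)_Q χ^i u^i v u^j` (`markedSum`), so that `W_{N-1} = v`.
Moving `x_1` to the marked place by Abel summation, and using that `Q` is a primitive `N`-th root of
unity, one finds (`map_markedSum`)
`D W_r = γ ((r+1)_Q (1 - Q^{-r} a^{2n} s) - b) W_{r+1}`.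
For `r ≥ 1` the scalar is `γ (r+1)_Q d_{N-1-r}` (`descent_scalar_eq_mul_d`), and for `r = 0` it is
`-γ a (n)_a (1 - a^{n-1} s)` (`descent_scalar_zero`). If no `d_t` with `1 ≤ t ≤ N - 2` vanished, and
if `γ` and the scalar for `r = 0` are nonzero, then `v ∈ J`, a contradiction.

The nonvanishing of the remaining factors also follows from `v ∉ J`. If `a^{m-1} s = 1` for some
`1 ≤ m ≤ n`, the explicit coproduct of `y_m` (`mulComul_liftY`) shows that `y_m` is primitive, so it
lies in `J` (`mem_nicholsIdeal_of_primitive`). If `(m)_a = 0` with `m` minimal, then `x_1^m` is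
primitive by the `q`-binomial theorem, and `y_m = x_1^m x_2 + w x_1^m` lies in `J`. In both cases
`y_{n+1} ∈ J`.
-/

open Finset.HasAntidiagonal (antidiagonal)

noncomputable section

namespace NicholsDiag

/-! ### Gaussian binomial coefficients -/

section Gaussian

variable {k : Type*} [Field k]

theorem qInt_zero (a : k) : qInt a 0 = 0 := by simp [qInt]

theorem qInt_one (a : k) : qInt a 1 = 1 := by simp [qInt]

theorem qInt_succ (a : k) (n : ℕ) : qInt a (n + 1) = qInt a n + a ^ n := by
  simp [qInt, Finset.sum_range_succ]

theorem qInt_succ' (a : k) (n : ℕ) : qInt a (n + 1) = a * qInt a n + 1 := by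
  simp [qInt, Finset.sum_range_succ', Finset.mul_sum, pow_succ']

theorem qInt_add (a : k) (m n : ℕ) : qInt a (m + n) = qInt a m + a ^ m * qInt a n := by
  simp [qInt, Finset.sum_range_add, Finset.mul_sum, pow_add]

theorem qInt_mul_sub_one (a : k) (n : ℕ) : qInt a n * (a - 1) = a ^ n - 1 :=
  geom_sum_mul a n

theorem qInt_eq_zero_of_isPrimitiveRoot {a : k} {N : ℕ} (h : IsPrimitiveRoot a N) (hN : 2 ≤ N) :
    qInt a N = 0 :=
  h.geom_sum_eq_zero hN

theorem qInt_ne_zero_of_isPrimitiveRoot {a : k} {N t : ℕ} (h : IsPrimitiveRoot a N) (ht : 0 < t)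
    (htN : t < N) : qInt a t ≠ 0 := by
  intro h0
  have := qInt_mul_sub_one a t
  rw [h0, zero_mul] at this
  exact h.pow_ne_one_of_pos_of_lt ht.ne' htN (sub_eq_zero.1 this.symm)

/-- The Gaussian binomial coefficients at `a`, defined by the Pascal rule (so that no division by
quantum integers, which may vanish, is involved). -/
def gaussBinom (a : k) : ℕ → ℕ → k
  | _, 0 => 1
  | 0, _ + 1 => 0
  | n + 1, r + 1 => gaussBinom a n r + a ^ (r + 1) * gaussBinom a n (r + 1)

@[simp] theorem gaussBinom_zero_right (a : k) (n : ℕ) : gaussBinom a n 0 = 1 := by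
  cases n <;> rfl

theorem gaussBinom_succ_succ (a : k) (n r : ℕ) : gaussBinom a (n + 1) (r + 1) =
    gaussBinom a n r + a ^ (r + 1) * gaussBinom a n (r + 1) := rfl

theorem gaussBinom_eq_zero_of_lt (a : k) {n r : ℕ} (h : n < r) : gaussBinom a n r = 0 := by
  induction n generalizing r with
  | zero => cases r with
    | zero => omega
    | succ r => rfl
  | succ n ih => cases r with
    | zero => omega
    | succ r => rw [gaussBinom_succ_succ, ih (by omega), ih (by omega)]; simp

@[simp] theorem gaussBinom_self (a : k) (n : ℕ) : gaussBinom a n n = 1 := by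
  induction n with
  | zero => rfl
  | succ n ih => rw [gaussBinom_succ_succ, ih, gaussBinom_eq_zero_of_lt a (by omega)]; simp

/-- The second Pascal rule. -/
theorem gaussBinom_add_succ (a : k) (r j : ℕ) : gaussBinom a (r + j + 1) (r + 1) =
    gaussBinom a (r + j) (r + 1) + a ^ j * gaussBinom a (r + j) r := by
  induction r generalizing j with
  | zero =>
    induction j with
    | zero => simp [gaussBinom]
    | succ j ih =>
      have h := gaussBinom_succ_succ a (j + 1) 0
      have h' := gaussBinom_succ_succ a j 0
      simp only [Nat.zero_add, gaussBinom_zero_right, pow_one] at *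
      linear_combination h - h' + a * ih
  | succ r ihr =>
    induction j with
    | zero => simp [gaussBinom_eq_zero_of_lt a (show r + 1 < r + 2 by omega)]
    | succ j ihj =>
      have e1 := gaussBinom_succ_succ a (r + 1 + (j + 1)) (r + 1)
      have e2 := gaussBinom_succ_succ a (r + 1 + j) (r + 1)
      have e3 := gaussBinom_succ_succ a (r + j + 1) r
      have e4 := ihr (j + 1)
      simp only [show r + 1 + (j + 1) = r + 1 + j + 1 by omega,
        show r + (j + 1) = r + 1 + j by omega, show r + j + 1 = r + 1 + j by omega] at *
      linear_combination e1 - e2 + e4 + a ^ (r + 1 + 1) * ihj - a ^ (j + 1) * e3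

/-- The absorption rule. -/
theorem qInt_mul_gaussBinom (a : k) (n r : ℕ) :
    qInt a (r + 1) * gaussBinom a (n + 1) (r + 1) = qInt a (n + 1) * gaussBinom a n r := by
  induction n generalizing r with
  | zero => cases r with
    | zero => simp
    | succ r => simp [gaussBinom_eq_zero_of_lt]
  | succ n ih => cases r with
    | zero =>
      have h := ih 0
      rw [gaussBinom_succ_succ]
      simp only [Nat.zero_add, gaussBinom_zero_right, qInt_one] at *
      rw [qInt_succ' a (n + 1)]
      linear_combination a * h
    | succ r =>
      have h1 := ih r
      have h2 := ih (r + 1)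
      have e1 := gaussBinom_succ_succ a (n + 1) (r + 1)
      have e2 := gaussBinom_succ_succ a n r
      have q1' := qInt_succ' a (r + 1)
      have q2' := qInt_succ' a (n + 1)
      rw [e1, q2']
      linear_combination a * h1 + a ^ (r + 1 + 1) * h2 +
        gaussBinom a (n + 1) (r + 1) * q1' - a * qInt a (n + 1) * e2

/-- The absorption rule in the upper-minus-lower index; the second Pascal rule makes it valid at
`a = 0` too. -/
theorem qInt_mul_gaussBinom_add (a : k) (r j : ℕ) :
    qInt a (j + 1) * gaussBinom a (r + j + 1) r =
      qInt a (r + 1) * gaussBinom a (r + 1 + j) (r + 1) := by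
  have h := qInt_mul_gaussBinom a (r + j + 1) r
  have e := gaussBinom_add_succ a r (j + 1)
  have h' := qInt_add a (j + 1) (r + 1)
  simp only [← add_assoc, show r + 1 + j = r + j + 1 by omega,
    show j + 1 + r + 1 = r + j + 1 + 1 by omega] at *
  linear_combination -h' * gaussBinom a (r + j + 1) r - h + qInt a (r + 1) * e

theorem gaussBinom_eq_zero {a : k} {N r : ℕ} (h : qInt a N = 0) (hr : 0 < r) (hr0 : qInt a r ≠ 0)
    (hN : 0 < N) : gaussBinom a N r = 0 := by
  obtain ⟨r, rfl⟩ := Nat.exists_eq_succ_of_ne_zero hr.ne'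
  obtain ⟨N, rfl⟩ := Nat.exists_eq_succ_of_ne_zero hN.ne'
  have := qInt_mul_gaussBinom a N r
  rw [Nat.succ_eq_add_one] at *
  rw [h, zero_mul] at this
  exact (mul_eq_zero.1 this).resolve_left hr0

theorem mul_pow_of_qComm {A : Type*} [Ring A] [Algebra k A] {a : k} {P Q : A}
    (h : Q * P = a • (P * Q)) (i : ℕ) : Q * P ^ i = a ^ i • (P ^ i * Q) := by
  induction i with
  | zero => simp
  | succ i ih =>
    rw [pow_succ, ← mul_assoc, ih, smul_mul_assoc, mul_assoc, h, mul_smul_comm, smul_smul,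
      ← pow_succ, mul_assoc]

/-- The `q`-binomial theorem. -/
theorem add_pow_of_qComm {A : Type*} [Ring A] [Algebra k A] {a : k} {P Q : A}
    (h : Q * P = a • (P * Q)) (m : ℕ) :
    (P + Q) ^ m = ∑ ij ∈ antidiagonal m, gaussBinom a m ij.1 • (P ^ ij.1 * Q ^ ij.2) := by
  induction m with
  | zero => simp
  | succ m ih =>
    have key : ∀ ij ∈ antidiagonal (m + 1), gaussBinom a (m + 1) ij.1 • (P ^ ij.1 * Q ^ ij.2) =
        (if ij.1 = 0 then 0 else gaussBinom a m (ij.1 - 1) • (P ^ ij.1 * Q ^ ij.2)) +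
        (a ^ ij.1 * gaussBinom a m ij.1) • (P ^ ij.1 * Q ^ ij.2) := by
      rintro ⟨i, j⟩ -
      cases i with
      | zero => simp
      | succ i => simp [gaussBinom_succ_succ, add_smul]
    rw [Finset.sum_congr rfl key, Finset.sum_add_distrib,
      Finset.Nat.sum_antidiagonal_succ, Finset.Nat.sum_antidiagonal_succ', pow_succ', ih, add_mul,
      Finset.mul_sum, Finset.mul_sum]
    simp only [gaussBinom_eq_zero_of_lt a (Nat.lt_succ_self m), if_true, zero_add, mul_zero,
      zero_smul, Nat.succ_ne_zero, if_false, Nat.add_sub_cancel]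
    congr 1
    · refine Finset.sum_congr rfl fun ij _ => ?_
      rw [mul_smul_comm, ← mul_assoc, ← pow_succ']
    · refine Finset.sum_congr rfl fun ij _ => ?_
      rw [mul_smul_comm, ← mul_assoc, mul_pow_of_qComm h, smul_mul_assoc, smul_smul, mul_assoc,
        ← pow_succ', mul_comm]

/-- If `m > 0` is minimal with `(m)_a = 0`, the middle terms of the `q`-binomial theorem
vanish. -/
theorem add_pow_of_qComm_of_qInt_eq_zero {A : Type*} [Ring A] [Algebra k A] {a : k} {P Q : A}
    (h : Q * P = a • (P * Q)) {m : ℕ} (hm : 0 < m) (h0 : qInt a m = 0)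
    (hlt : ∀ j, 0 < j → j < m → qInt a j ≠ 0) : (P + Q) ^ m = P ^ m + Q ^ m := by
  obtain ⟨m, rfl⟩ := Nat.exists_eq_succ_of_ne_zero hm.ne'
  rw [Nat.succ_eq_add_one] at *
  rw [add_pow_of_qComm h, Finset.Nat.sum_antidiagonal_succ]
  cases m with
  | zero => simp [add_comm]
  | succ m =>
    rw [Finset.Nat.sum_antidiagonal_succ', Finset.sum_eq_zero]
    · simp [add_comm]
    · rintro ⟨i, j⟩ hij
      rw [Finset.HasAntidiagonal.mem_antidiagonal] at hij
      simp only at hij ⊢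
      rw [gaussBinom_eq_zero h0 (Nat.succ_pos _) (hlt _ (Nat.succ_pos _) (by omega))
        (Nat.succ_pos _), zero_smul]

end Gaussian

/-! ### Sums of words with one marked letter -/

section MarkedWords

variable {k : Type*} [Field k] {A : Type*} [Ring A] [Algebra k A]

/-- `∑_{i + j = m} binom(r + j, r)_a χ^i u^i v u^j`, a combination of the words with `m` letters
`u` and one letter `v`. -/
def markedSum (a χ : k) (u v : A) (r m : ℕ) : A :=
  ∑ ij ∈ antidiagonal m,
    (gaussBinom a (r + ij.2) r * χ ^ ij.1) • (u ^ ij.1 * v * u ^ ij.2)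

theorem markedSum_zero_right (a χ : k) (u v : A) (r : ℕ) : markedSum a χ u v r 0 = v := by
  simp [markedSum]

/-- Abel summation, the differences of the terms being controlled by `x u = χ u x + v`. -/
theorem sum_gaussBinom_smul (a χ : k) {x u v : A} (hx : x * u = χ • (u * x) + v) (r m : ℕ) :
    ∑ ij ∈ antidiagonal (m + 1),
      (gaussBinom a (r + ij.2) r * χ ^ ij.1 * a ^ ij.2) • (u ^ ij.1 * x * u ^ ij.2) =
    gaussBinom a (r + (m + 1) + 1) (r + 1) • (x * u ^ (m + 1)) - markedSum a χ u v (r + 1) m := by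
  have h1 : ∀ ij ∈ antidiagonal (m + 1),
      (gaussBinom a (r + ij.2) r * χ ^ ij.1 * a ^ ij.2) • (u ^ ij.1 * x * u ^ ij.2) =
      (gaussBinom a (r + ij.2 + 1) (r + 1) * χ ^ ij.1) • (u ^ ij.1 * x * u ^ ij.2) -
      (gaussBinom a (r + ij.2) (r + 1) * χ ^ ij.1) • (u ^ ij.1 * x * u ^ ij.2) := by
    rintro ⟨i, j⟩ -
    rw [← sub_smul]
    congr 1
    linear_combination (-χ ^ i) * gaussBinom_add_succ a r j
  rw [Finset.sum_congr rfl h1, Finset.sum_sub_distrib, Finset.Nat.sum_antidiagonal_succ,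
    Finset.Nat.sum_antidiagonal_succ' (f := fun ij : ℕ × ℕ =>
      (gaussBinom a (r + ij.2) (r + 1) * χ ^ ij.1) • (u ^ ij.1 * x * u ^ ij.2))]
  simp only [gaussBinom_eq_zero_of_lt a (show r + 0 < r + 1 by omega), zero_mul, zero_smul,
    zero_add, pow_zero, mul_one, one_mul]
  rw [add_sub_assoc, ← Finset.sum_sub_distrib, sub_eq_add_neg, markedSum, ← Finset.sum_neg_distrib]
  congr 1
  refine Finset.sum_congr rfl fun ij _ => ?_
  obtain ⟨i, j⟩ := ij
  simp only
  rw [show u ^ (i + 1) * x * u ^ j = u ^ i * (u * x) * u ^ j by simp only [pow_succ, mul_assoc],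
    show u ^ i * x * u ^ (j + 1) = u ^ i * (x * u) * u ^ j by simp only [pow_succ', mul_assoc], hx,
    mul_add, add_mul, mul_smul_comm, smul_mul_assoc, show r + (j + 1) = r + j + 1 by omega,
    show r + 1 + j = r + j + 1 by omega, pow_succ]
  module

/-- The skew commutator of `x` with a power of `u` is a marked sum. -/
theorem mul_pow_eq_markedSum (a χ : k) {x u v : A} (hx : x * u = χ • (u * x) + v) (m : ℕ) :
    x * u ^ (m + 1) = χ ^ (m + 1) • (u ^ (m + 1) * x) + markedSum a χ u v 0 m := by
  induction m with
  | zero => simp [markedSum, hx]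
  | succ m ih =>
    rw [markedSum, Finset.Nat.sum_antidiagonal_succ', pow_succ, ← mul_assoc, ih, add_mul,
      smul_mul_assoc, mul_assoc, hx, markedSum, Finset.sum_mul]
    simp only [gaussBinom_zero_right, one_mul, pow_zero, mul_one, smul_mul_assoc, mul_add,
      mul_smul_comm, smul_add, smul_smul]
    rw [← pow_succ, ← mul_assoc, add_assoc]
    congr 2
    simp only [pow_succ, mul_assoc]

/-- One step of the descent: if `D` acts on the words `u^i v u^j` as a skew derivation with
`D u = γ` and `D v = γ b x`, then it maps the marked sums to each other. -/
theorem map_markedSum (D : A →ₗ[k] A) {a χ μ γ b e : k} {x u v : A}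
    (hx : x * u = χ • (u * x) + v)
    (hD : ∀ i j, D (u ^ i * v * u ^ j) =
      γ • (qInt a j • (u ^ i * v * u ^ (j - 1)) +
        (qInt a i * μ * a ^ j) • (u ^ (i - 1) * v * u ^ j) + (b * a ^ j) • (u ^ i * x * u ^ j)))
    (he : χ * μ = a * e) {r m : ℕ} (ha : IsPrimitiveRoot a (r + m + 2)) :
    D (markedSum a χ u v r (m + 1)) =
      (γ * (qInt a (r + 1) * (1 - e / a ^ r) - b)) • markedSum a χ u v (r + 1) m := by
  have ha0 : a ≠ 0 := ha.ne_zero (by omega)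
  have hz : qInt a (r + m + 2) = 0 := qInt_eq_zero_of_isPrimitiveRoot ha (by omega)
  have hB : gaussBinom a (r + (m + 1) + 1) (r + 1) = 0 :=
    gaussBinom_eq_zero (by rw [← hz]; rfl) (Nat.succ_pos _)
      (qInt_ne_zero_of_isPrimitiveRoot ha (Nat.succ_pos _) (by omega)) (Nat.succ_pos _)
  have h3 := sum_gaussBinom_smul a χ hx r m
  rw [hB, zero_smul, zero_sub] at h3
  have h1 : ∑ ij ∈ antidiagonal (m + 1), (gaussBinom a (r + ij.2) r * χ ^ ij.1 * qInt a ij.2) •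
      (u ^ ij.1 * v * u ^ (ij.2 - 1)) = qInt a (r + 1) • markedSum a χ u v (r + 1) m := by
    rw [Finset.Nat.sum_antidiagonal_succ', markedSum, Finset.smul_sum]
    simp only [qInt_zero, mul_zero, zero_smul, zero_add, Nat.add_sub_cancel, smul_smul]
    refine Finset.sum_congr rfl fun ij _ => ?_
    congr 1
    linear_combination χ ^ ij.1 * qInt_mul_gaussBinom_add a r ij.2
  have h2 : ∑ ij ∈ antidiagonal (m + 1),
      (gaussBinom a (r + ij.2) r * χ ^ ij.1 * (qInt a ij.1 * μ * a ^ ij.2)) •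
        (u ^ (ij.1 - 1) * v * u ^ ij.2) =
      (-(qInt a (r + 1) * (e / a ^ r))) • markedSum a χ u v (r + 1) m := by
    rw [Finset.Nat.sum_antidiagonal_succ, markedSum, Finset.smul_sum]
    simp only [qInt_zero, mul_zero, zero_mul, zero_smul, zero_add, Nat.add_sub_cancel, smul_smul]
    refine Finset.sum_congr rfl fun ij hij => ?_
    obtain ⟨i, j⟩ := ij
    rw [Finset.HasAntidiagonal.mem_antidiagonal] at hij
    simp only at hij ⊢
    congr 1
    -- Since `(r + m + 2)_a = 0`, the factor `(i + 1)_a` is a multiple of `(r + j + 1)_a`.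
    have k1 := qInt_mul_gaussBinom a (r + j) r
    have k2 := qInt_add a (r + j + 1) (i + 1)
    rw [show r + j + 1 + (i + 1) = r + m + 2 by omega, hz] at k2
    rw [show r + 1 + j = r + j + 1 by omega]
    have hr : a ^ r ≠ 0 := pow_ne_zero _ ha0
    field_simp
    rw [pow_succ]
    have k3 : a ^ (r + j + 1) = a * a ^ r * a ^ j := by ring
    rw [k3] at k2
    linear_combination (gaussBinom a (r + j) r * χ ^ i * qInt a (i + 1) * a ^ j * a ^ r) * he
      - e * χ ^ i * gaussBinom a (r + j) r * k2 + e * χ ^ i * k1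
  have : D (markedSum a χ u v r (m + 1)) =
      γ • (∑ ij ∈ antidiagonal (m + 1), (gaussBinom a (r + ij.2) r * χ ^ ij.1 * qInt a ij.2) •
        (u ^ ij.1 * v * u ^ (ij.2 - 1)) +
      ∑ ij ∈ antidiagonal (m + 1),
        (gaussBinom a (r + ij.2) r * χ ^ ij.1 * (qInt a ij.1 * μ * a ^ ij.2)) •
        (u ^ (ij.1 - 1) * v * u ^ ij.2) +
      b • ∑ ij ∈ antidiagonal (m + 1),
        (gaussBinom a (r + ij.2) r * χ ^ ij.1 * a ^ ij.2) • (u ^ ij.1 * x * u ^ ij.2)) := by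
    rw [markedSum, map_sum, Finset.smul_sum, ← Finset.sum_add_distrib, ← Finset.sum_add_distrib,
      Finset.smul_sum]
    refine Finset.sum_congr rfl fun ij _ => ?_
    rw [map_smul, hD]
    module
  rw [this, h1, h2, h3]
  module

end MarkedWords

/-! ### An expansion of iterated skew commutators -/

section Expansion

variable {k : Type*} [Field k] {A : Type*} [Ring A] [Algebra k A]

/-- `binom(i + j, i)_a ∏_{l < j} (1 - a^(i + l) s)`, which for `a = q_11` and `s = q_12 q_21` is the
coefficient of `x_1^j ⊗ y_i` in the coproduct of `y_{i+j}`. -/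
def coprodCoeff (a s : k) (i j : ℕ) : k :=
  gaussBinom a (i + j) i * ∏ l ∈ Finset.range j, (1 - a ^ (i + l) * s)

theorem coprodCoeff_zero_right (a s : k) (i : ℕ) : coprodCoeff a s i 0 = 1 := by
  simp [coprodCoeff]

theorem coprodCoeff_zero_succ (a s : k) (j : ℕ) :
    coprodCoeff a s 0 (j + 1) = coprodCoeff a s 0 j * (1 - a ^ j * s) := by
  simp [coprodCoeff, Finset.prod_range_succ]

theorem coprodCoeff_succ_succ (a s : k) (i j : ℕ) : coprodCoeff a s (i + 1) (j + 1) =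
    coprodCoeff a s (i + 1) j * (1 - a ^ (2 * (i + 1) + j) * s) +
      a ^ (j + 1) * coprodCoeff a s i (j + 1) := by
  have h1 := gaussBinom_succ_succ a (i + j + 1) i
  have h2 := gaussBinom_add_succ a i (j + 1)
  have h3 : ∏ l ∈ Finset.range (j + 1), (1 - a ^ (i + l) * s) =
      (∏ l ∈ Finset.range j, (1 - a ^ (i + 1 + l) * s)) * (1 - a ^ i * s) := by
    rw [Finset.prod_range_succ', add_zero]
    refine congrArg (· * _) (Finset.prod_congr rfl fun l _ => ?_)
    rw [show i + (l + 1) = i + 1 + l by omega]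
  simp only [coprodCoeff, h3, Finset.prod_range_succ _ j]
  rw [show i + 1 + (j + 1) = i + j + 1 + 1 by omega, show i + 1 + j = i + j + 1 by omega,
    show i + (j + 1) = i + j + 1 by omega] at *
  set c := ∏ l ∈ Finset.range j, (1 - a ^ (i + 1 + l) * s)
  linear_combination c * h2 - c * a ^ (i + j + 1) * s * h1

theorem coprodCoeff_eq_zero {a s : k} {i j : ℕ} (hj : 0 < j) (h : a ^ (i + j - 1) * s = 1) :
    coprodCoeff a s i j = 0 := by
  obtain ⟨j, rfl⟩ := Nat.exists_eq_succ_of_ne_zero hj.ne'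
  rw [coprodCoeff, Finset.prod_range_succ]
  simp only [Nat.succ_eq_add_one, ← add_assoc, Nat.add_sub_cancel] at h
  simp [h]

/-- The sequence `X (m + 1) = (P + Q) X m - a^m t X m (P + Q)` in terms of `P` and the analogous
sequences `Y` for `P` and `Z` for `Q`. -/
theorem skewComm_expansion {a t t' : k} {P Q : A} {X Y Z : ℕ → A} (hQP : Q * P = a • (P * Q))
    (hX0 : X 0 = Y 0 + Z 0)
    (hX : ∀ m, X (m + 1) = (P + Q) * X m - (a ^ m * t) • (X m * (P + Q)))
    (hPY : ∀ m, Y (m + 1) = P * Y m - (a ^ m * t) • (Y m * P))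
    (hQY : ∀ m, Q * Y m = (a ^ m * t) • (Y m * Q))
    (hZP : ∀ m, Z m * P = (a ^ m * t') • (P * Z m))
    (hQZ : ∀ m, Z (m + 1) = Q * Z m - (a ^ m * t) • (Z m * Q)) (m : ℕ) :
    X m = Y m + ∑ ij ∈ antidiagonal m, coprodCoeff a (t * t') ij.1 ij.2 • (P ^ ij.2 * Z ij.1) := by
  induction m with
  | zero => simp [hX0, coprodCoeff_zero_right]
  | succ m ih =>
    have key : ∀ ij ∈ antidiagonal (m + 1),
        coprodCoeff a (t * t') ij.1 ij.2 • (P ^ ij.2 * Z ij.1) =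
        (if ij.2 = 0 then 0 else (coprodCoeff a (t * t') ij.1 (ij.2 - 1) *
          (1 - a ^ (2 * ij.1 + (ij.2 - 1)) * (t * t'))) • (P ^ ij.2 * Z ij.1)) +
        (if ij.1 = 0 then 0 else
          (a ^ ij.2 * coprodCoeff a (t * t') (ij.1 - 1) ij.2) • (P ^ ij.2 * Z ij.1)) := by
      rintro ⟨i, j⟩ hij
      rw [Finset.HasAntidiagonal.mem_antidiagonal] at hij
      rcases i with _ | i <;> rcases j with _ | j
      · simp at hij
      · simp [coprodCoeff_zero_succ]
      · simp [coprodCoeff_zero_right]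
      · simp [coprodCoeff_succ_succ, add_smul]
    have hterm : ∀ ij ∈ antidiagonal m,
        (P + Q) * (P ^ ij.2 * Z ij.1) - (a ^ m * t) • (P ^ ij.2 * Z ij.1 * (P + Q)) =
        (1 - a ^ (2 * ij.1 + ij.2) * (t * t')) • (P ^ (ij.2 + 1) * Z ij.1) +
          a ^ ij.2 • (P ^ ij.2 * Z (ij.1 + 1)) := by
      rintro ⟨i, j⟩ hij
      rw [Finset.HasAntidiagonal.mem_antidiagonal] at hij
      simp only at hij ⊢
      rw [add_mul, ← mul_assoc Q, mul_pow_of_qComm hQP, mul_add, mul_assoc (P ^ j) (Z i) P, hZP,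
        hQZ, ← hij]
      simp only [mul_smul_comm, smul_mul_assoc, mul_sub, smul_sub, smul_add, smul_smul, mul_assoc]
      rw [← mul_assoc P (P ^ j), ← pow_succ', ← mul_assoc (P ^ j) P, ← pow_succ]
      module
    rw [Finset.sum_congr rfl key, Finset.sum_add_distrib, Finset.Nat.sum_antidiagonal_succ',
      Finset.Nat.sum_antidiagonal_succ, hX, ih, mul_add, add_mul _ _ (P + Q), Finset.mul_sum,
      Finset.sum_mul]
    simp only [if_true, zero_add, Nat.succ_ne_zero, if_false, Nat.add_sub_cancel]
    rw [← Finset.sum_add_distrib, hPY, add_mul P Q (Y m), mul_add (Y m) P Q, hQY, smul_add,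
      smul_add, Finset.smul_sum]
    have h2 : ∑ i ∈ antidiagonal m, (P + Q) * coprodCoeff a (t * t') i.1 i.2 • (P ^ i.2 * Z i.1) -
        ∑ i ∈ antidiagonal m,
          (a ^ m * t) • (coprodCoeff a (t * t') i.1 i.2 • (P ^ i.2 * Z i.1) * (P + Q)) =
        ∑ i ∈ antidiagonal m, ((coprodCoeff a (t * t') i.1 i.2 *
          (1 - a ^ (2 * i.1 + i.2) * (t * t'))) • (P ^ (i.2 + 1) * Z i.1) +
          (a ^ i.2 * coprodCoeff a (t * t') i.1 i.2) • (P ^ i.2 * Z (i.1 + 1))) := by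
      rw [← Finset.sum_sub_distrib]
      refine Finset.sum_congr rfl fun ij hij => ?_
      have := hterm ij hij
      rw [mul_smul_comm, smul_mul_assoc, smul_comm, ← smul_sub, this]
      module
    rw [← h2]
    abel

end Expansion

/-! ### Primitive elements generate graded coideals -/

section PrimitiveIdeal

variable {k : Type*} [Field k] {ι : Type*} (q : ι → ι → k)

theorem mem_toSubspace {I : TwoSidedIdeal (FreeAlgebra k ι)} {x : FreeAlgebra k ι} :
    x ∈ toSubspace I ↔ x ∈ I := TwoSidedIdeal.mem_asIdeal

theorem smul_mem_twoSidedIdeal (I : TwoSidedIdeal (FreeAlgebra k ι)) (c : k)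
    {x : FreeAlgebra k ι} (hx : x ∈ I) : c • x ∈ I :=
  mem_toSubspace.1 ((toSubspace I).smul_mem c hx)

/-- Left multiplication by `Δ(x)` in the braided tensor product algebra `T(V) ⊗ T(V)`. -/
def mulComul : FreeAlgebra k ι →ₐ[k] Module.End k (FreeAlgebra k ι ⊗[k] FreeAlgebra k ι) :=
  FreeAlgebra.lift k (mulPrimitive q)

theorem mulComul_ι (i : ι) : mulComul q (FreeAlgebra.ι k i) = mulPrimitive q i :=
  FreeAlgebra.lift_ι_apply _ _

theorem comul_mul (x z : FreeAlgebra k ι) : comul q (x * z) = mulComul q x (comul q z) := by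
  change mulComul q (x * z) _ = mulComul q x (mulComul q z _)
  rw [map_mul]; rfl

theorem comul_one : comul q (1 : FreeAlgebra k ι) = 1 ⊗ₜ 1 := by
  change mulComul q 1 _ = _
  rw [map_one]; rfl

theorem act_ι (i j : ι) : act q i (FreeAlgebra.ι k j) = q i j • FreeAlgebra.ι k j :=
  FreeAlgebra.lift_ι_apply _ _

theorem mulPrimitive_tmul (i : ι) (a b : FreeAlgebra k ι) : mulPrimitive q i (a ⊗ₜ b) =
    (FreeAlgebra.ι k i * a) ⊗ₜ b + act q i a ⊗ₜ (FreeAlgebra.ι k i * b) := rfl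

/-- The subspace `S ⊗ T(V) + T(V) ⊗ S` of `T(V) ⊗ T(V)`. -/
def coidealSubspace (S : Submodule k (FreeAlgebra k ι)) :
    Submodule k (FreeAlgebra k ι ⊗[k] FreeAlgebra k ι) :=
  LinearMap.range (TensorProduct.map S.subtype
      (LinearMap.id : FreeAlgebra k ι →ₗ[k] FreeAlgebra k ι)) ⊔
    LinearMap.range (TensorProduct.map
      (LinearMap.id : FreeAlgebra k ι →ₗ[k] FreeAlgebra k ι) S.subtype)

theorem tmul_mem_left {S : Submodule k (FreeAlgebra k ι)} {a : FreeAlgebra k ι} (ha : a ∈ S)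
    (b : FreeAlgebra k ι) : a ⊗ₜ b ∈ coidealSubspace S :=
  Submodule.mem_sup_left ⟨(⟨a, ha⟩ : S) ⊗ₜ b, rfl⟩

theorem tmul_mem_right {S : Submodule k (FreeAlgebra k ι)} {b : FreeAlgebra k ι} (hb : b ∈ S)
    (a : FreeAlgebra k ι) : a ⊗ₜ b ∈ coidealSubspace S :=
  Submodule.mem_sup_right ⟨a ⊗ₜ (⟨b, hb⟩ : S), rfl⟩

theorem coidealSubspace_le {S : Submodule k (FreeAlgebra k ι)}
    {M : Submodule k (FreeAlgebra k ι ⊗[k] FreeAlgebra k ι)}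
    (h1 : ∀ a ∈ S, ∀ b, a ⊗ₜ b ∈ M) (h2 : ∀ b ∈ S, ∀ a, a ⊗ₜ b ∈ M) : coidealSubspace S ≤ M := by
  refine sup_le ?_ ?_
  · rintro _ ⟨x, rfl⟩
    induction x with
    | zero => simp
    | tmul a b => exact h1 a.1 a.2 b
    | add x y hx hy => rw [map_add]; exact M.add_mem hx hy
  · rintro _ ⟨x, rfl⟩
    induction x with
    | zero => simp
    | tmul a b => exact h2 b.1 b.2 a
    | add x y hx hy => rw [map_add]; exact M.add_mem hx hy

theorem mulComul_mem_coidealSubspace {I : TwoSidedIdeal (FreeAlgebra k ι)}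
    (hact : ∀ i, ∀ x ∈ I, act q i x ∈ I) (u : FreeAlgebra k ι)
    {X : FreeAlgebra k ι ⊗[k] FreeAlgebra k ι} (hX : X ∈ coidealSubspace (toSubspace I)) :
    mulComul q u X ∈ coidealSubspace (toSubspace I) := by
  induction u generalizing X with
  | grade0 r =>
    rw [AlgHom.commutes]
    exact Submodule.smul_mem _ r hX
  | grade1 i =>
    rw [mulComul_ι]
    refine coidealSubspace_le (M := (coidealSubspace (toSubspace I)).comap (mulPrimitive q i))
      (fun a ha b => ?_) (fun b hb a => ?_) hX
    · rw [Submodule.mem_comap, mulPrimitive_tmul]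
      exact Submodule.add_mem _ (tmul_mem_left (I.mul_mem_left _ _ ha) _)
        (tmul_mem_left (hact i a ha) _)
    · rw [Submodule.mem_comap, mulPrimitive_tmul]
      exact Submodule.add_mem _ (tmul_mem_right hb _)
        (tmul_mem_right (I.mul_mem_left _ _ hb) _)
  | mul u v hu hv => rw [map_mul]; exact hu (hv hX)
  | add u v hu hv => rw [map_add]; exact Submodule.add_mem _ (hu hX) (hv hX)

theorem ι_mem_degreePart (i : ι) : FreeAlgebra.ι k i ∈ degreePart k ι 1 := by
  rw [degreePart, pow_one]
  exact Submodule.subset_span ⟨i, rfl⟩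

theorem mul_mem_degreePart {m n : ℕ} {x z : FreeAlgebra k ι} (hx : x ∈ degreePart k ι m)
    (hz : z ∈ degreePart k ι n) : x * z ∈ degreePart k ι (m + n) := by
  rw [degreePart, pow_add]
  exact Submodule.mul_mem_mul hx hz

theorem mem_iSup_degreePart {I : TwoSidedIdeal (FreeAlgebra k ι)} {n : ℕ} (hn : 2 ≤ n)
    {x : FreeAlgebra k ι} (hx : x ∈ I) (hx' : x ∈ degreePart k ι n) :
    x ∈ ⨆ n ∈ Set.Ici 2, toSubspace I ⊓ degreePart k ι n :=
  Submodule.mem_iSup_of_mem n (Submodule.mem_iSup_of_mem hn ⟨hx, hx'⟩)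

/-- The part of an ideal spanned by its homogeneous elements of degree at least two is stable under
multiplications on both sides. -/
theorem mul_mul_mem_iSup_degreePart (I : TwoSidedIdeal (FreeAlgebra k ι))
    {s : FreeAlgebra k ι} (hs : s ∈ ⨆ n ∈ Set.Ici 2, toSubspace I ⊓ degreePart k ι n)
    (u v : FreeAlgebra k ι) :
    u * s * v ∈ ⨆ n ∈ Set.Ici 2, toSubspace I ⊓ degreePart k ι n := by
  set H := ⨆ n ∈ Set.Ici 2, toSubspace I ⊓ degreePart k ι n
  have hleft (i : ι) : H ≤ H.comap (LinearMap.mulLeft k (FreeAlgebra.ι k i)) :=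
    iSup₂_le fun n (hn : 2 ≤ n) x hx => mem_iSup_degreePart (show 2 ≤ 1 + n by omega)
      (I.mul_mem_left _ _ hx.1)
      (mul_mem_degreePart (ι_mem_degreePart i) hx.2)
  have hright (i : ι) : H ≤ H.comap (LinearMap.mulRight k (FreeAlgebra.ι k i)) :=
    iSup₂_le fun n (hn : 2 ≤ n) x hx => mem_iSup_degreePart (show 2 ≤ n + 1 by omega)
      (I.mul_mem_right _ _ hx.1)
      (mul_mem_degreePart hx.2 (ι_mem_degreePart i))
  have h1 (u : FreeAlgebra k ι) : ∀ s ∈ H, u * s ∈ H := by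
    induction u with
    | grade0 r =>
      intro s hs
      rw [← Algebra.smul_def]
      exact H.smul_mem r hs
    | grade1 i => exact hleft i
    | mul u v hu hv => intro s hs; rw [mul_assoc]; exact hu _ (hv _ hs)
    | add u v hu hv => intro s hs; rw [add_mul]; exact H.add_mem (hu _ hs) (hv _ hs)
  have h2 (u : FreeAlgebra k ι) : ∀ s ∈ H, s * u ∈ H := by
    induction u with
    | grade0 r =>
      intro s hs
      rw [← Algebra.commutes, ← Algebra.smul_def]
      exact H.smul_mem r hs
    | grade1 i => exact hright i
    | mul u v hu hv => intro s hs; rw [← mul_assoc]; exact hv _ (hu _ hs)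
    | add u v hu hv => intro s hs; rw [mul_add]; exact H.add_mem (hu _ hs) (hv _ hs)
  exact h2 v _ (h1 u _ hs)

/-- A homogeneous primitive element of degree at least two, which is an eigenvector for the action
of the group-like elements, vanishes in the Nichols algebra. -/
theorem mem_nicholsIdeal_of_primitive {s : FreeAlgebra k ι} {d : ℕ} (hd : 2 ≤ d)
    (hs : s ∈ degreePart k ι d) {c : ι → k} (hact : ∀ i, act q i s = c i • s)
    (g : FreeAlgebra k ι →ₗ[k] FreeAlgebra k ι)
    (hprim : mulComul q s = TensorProduct.map (LinearMap.mulLeft k s) LinearMap.id +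
      TensorProduct.map g (LinearMap.mulLeft k s)) : s ∈ nicholsIdeal q := by
  set I : TwoSidedIdeal (FreeAlgebra k ι) := TwoSidedIdeal.span {s} with hI
  have hsI : s ∈ I := TwoSidedIdeal.subset_span rfl
  have hind {M : Submodule k (FreeAlgebra k ι)} (hM : ∀ u v, u * s * v ∈ M) :
      ∀ x ∈ I, x ∈ M := by
    intro x hx
    rw [hI, TwoSidedIdeal.mem_span_iff_mem_addSubgroup_closure] at hx
    refine (AddSubgroup.closure_le M.toAddSubgroup).2 ?_ hx
    rintro _ ⟨_, ⟨u, -, _, rfl, rfl⟩, v, -, rfl⟩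
    exact hM u v
  have hactI : ∀ i, ∀ x ∈ I, act q i x ∈ I := fun i =>
    hind (M := (toSubspace I).comap (act q i).toLinearMap) fun u v => by
      change act q i (u * s * v) ∈ I
      rw [map_mul, map_mul, hact]
      exact I.mul_mem_right _ _ (I.mul_mem_left _ _ (smul_mem_twoSidedIdeal I _ hsI))
  suffices hgr : IsGradedCoideal q I from (show I ≤ nicholsIdeal q from le_sSup hgr) hsI
  refine ⟨le_antisymm ?_ ?_, ?_⟩
  · refine hind fun u v => mul_mul_mem_iSup_degreePart I ?_ u v
    exact mem_iSup_degreePart hd hsI hs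
  · exact iSup₂_le fun n _ => inf_le_left
  · refine hind (M := (coidealSubspace (toSubspace I)).comap (comul q)) fun u v => ?_
    rw [Submodule.mem_comap, mul_assoc, comul_mul, comul_mul, hprim]
    refine mulComul_mem_coidealSubspace q hactI u ?_
    generalize comul q v = X
    induction X with
    | zero => simp
    | tmul a b =>
      exact Submodule.add_mem _ (tmul_mem_left (I.mul_mem_right _ _ hsI) _)
        (tmul_mem_right (I.mul_mem_right _ _ hsI) _)
    | add X Y hX hY => rw [map_add]; exact Submodule.add_mem _ hX hY

end PrimitiveIdeal

/-! ### Skew derivations -/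

section Derivations

variable {k : Type*} [Field k] {ι : Type*} (q : ι → ι → k)

/-- The sum of the graded coideals as subspaces is already an ideal, so every element of `J(V)` is a
sum of elements of graded coideals. -/
theorem mem_iSup_of_mem_nicholsIdeal {x : FreeAlgebra k ι} (hx : x ∈ nicholsIdeal q) :
    x ∈ ⨆ I ∈ {I | IsGradedCoideal q I}, toSubspace I := by
  set H := ⨆ I ∈ {I | IsGradedCoideal q I}, toSubspace I
  have hle {I : TwoSidedIdeal (FreeAlgebra k ι)} (hI : IsGradedCoideal q I) {x : FreeAlgebra k ι}
      (hx : x ∈ I) : x ∈ H :=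
    Submodule.mem_iSup_of_mem I (Submodule.mem_iSup_of_mem hI hx)
  have hl (u : FreeAlgebra k ι) : H ≤ H.comap (LinearMap.mulLeft k u) :=
    iSup₂_le fun I hI x hx => hle hI (I.mul_mem_left u x hx)
  have hr (u : FreeAlgebra k ι) : H ≤ H.comap (LinearMap.mulRight k u) :=
    iSup₂_le fun I hI x hx => hle hI (I.mul_mem_right x u hx)
  let K : TwoSidedIdeal (FreeAlgebra k ι) := TwoSidedIdeal.mk' H H.zero_mem H.add_mem H.neg_mem
    (fun {u} {_} h => hl u h) (fun {_} {u} h => hr u h)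
  have hK : nicholsIdeal q ≤ K := sSup_le fun I hI x hx =>
    (TwoSidedIdeal.mem_mk' _ _ _ _ _ _ x).2 (hle hI hx)
  exact (TwoSidedIdeal.mem_mk' _ _ _ _ _ _ x).1 (hK hx)

open Classical in
/-- The algebra morphism from `T(V)` to the dual numbers with `x_j ↦ δ_ij ε`; it records the terms
of degree zero and the coefficient of `x_i`. -/
def dualNumberHom (k : Type*) [Field k] {ι : Type*} (i : ι) :
    FreeAlgebra k ι →ₐ[k] TrivSqZeroExt k k :=
  FreeAlgebra.lift k fun j => TrivSqZeroExt.inr (if j = i then 1 else 0)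

/-- The coefficient of `x_i`, as a linear form on `T(V)`. -/
def coord (k : Type*) [Field k] {ι : Type*} (i : ι) : FreeAlgebra k ι →ₗ[k] k :=
  TrivSqZeroExt.sndHom k k ∘ₗ (dualNumberHom k i).toLinearMap

/-- The counit of `T(V)`. -/
def counit (k : Type*) [Field k] (ι : Type*) : FreeAlgebra k ι →ₐ[k] k :=
  FreeAlgebra.lift k fun _ => 0

open Classical in
theorem fst_dualNumberHom (i : ι) (x : FreeAlgebra k ι) :
    (dualNumberHom k i x).fst = counit k ι x := by
  have : (TrivSqZeroExt.fstHom k k k).comp (dualNumberHom k i) = counit k ι := by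
    refine FreeAlgebra.hom_ext (funext fun j => ?_)
    simp only [dualNumberHom, counit, Function.comp_apply, AlgHom.comp_apply,
      FreeAlgebra.lift_ι_apply]
    exact TrivSqZeroExt.fst_inr k (if j = i then (1 : k) else 0)
  exact DFunLike.congr_fun this x

open Classical in
theorem coord_ι_mul (i j : ι) (x : FreeAlgebra k ι) :
    coord k i (FreeAlgebra.ι k j * x) = if j = i then counit k ι x else 0 := by
  have h : dualNumberHom k i (FreeAlgebra.ι k j) = TrivSqZeroExt.inr (if j = i then 1 else 0) :=
    FreeAlgebra.lift_ι_apply _ _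
  change (dualNumberHom k i (FreeAlgebra.ι k j * x)).snd = _
  rw [map_mul, h, TrivSqZeroExt.snd_mul, fst_dualNumberHom]
  split_ifs <;> simp

theorem coord_one (i : ι) : coord k i (1 : FreeAlgebra k ι) = 0 := by
  change (dualNumberHom k i 1).snd = 0
  simp

theorem coord_eq_zero {n : ℕ} (hn : 2 ≤ n) (i : ι) {x : FreeAlgebra k ι}
    (hx : x ∈ degreePart k ι n) : coord k i x = 0 := by
  have hle : Submodule.span k (Set.range (FreeAlgebra.ι k : ι → FreeAlgebra k ι)) ≤
      LinearMap.ker (counit k ι).toLinearMap := by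
    rw [Submodule.span_le]
    rintro _ ⟨j, rfl⟩
    exact FreeAlgebra.lift_ι_apply _ _
  obtain ⟨n, rfl⟩ := Nat.exists_eq_add_of_le' hn
  have hxx : x ∈ degreePart k ι (n + 1) *
      Submodule.span k (Set.range (FreeAlgebra.ι k : ι → FreeAlgebra k ι)) := by
    rw [degreePart, ← pow_succ]; exact hx
  have hker : degreePart k ι (n + 1) ≤ LinearMap.ker (counit k ι).toLinearMap := by
    rw [degreePart, pow_succ]
    refine Submodule.mul_le.2 fun a _ b hb => ?_
    have : counit k ι b = 0 := hle hb
    change counit k ι (a * b) = 0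
    rw [map_mul, this, mul_zero]
  refine (Submodule.mul_le (P := LinearMap.ker (coord k i))).2 (fun a ha b hb => ?_) hxx
  have h1 : counit k ι a = 0 := hker ha
  have h2 : counit k ι b = 0 := hle hb
  change (dualNumberHom k i (a * b)).snd = 0
  rw [map_mul, TrivSqZeroExt.snd_mul, fst_dualNumberHom, fst_dualNumberHom, h1, h2]
  simp

/-- Contraction `a ⊗ b ↦ f(b) a` of the second tensor factor with a linear form. -/
def contract (f : FreeAlgebra k ι →ₗ[k] k) :
    FreeAlgebra k ι ⊗[k] FreeAlgebra k ι →ₗ[k] FreeAlgebra k ι :=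
  (TensorProduct.rid k _).toLinearMap ∘ₗ TensorProduct.map LinearMap.id f

theorem contract_tmul (f : FreeAlgebra k ι →ₗ[k] k) (a b : FreeAlgebra k ι) :
    contract f (a ⊗ₜ b) = f b • a := by
  simp [contract]

/-- The skew derivation `∂_i = (id ⊗ x_i^*) Δ` of `T(V)`. -/
def skewDer (i : ι) : FreeAlgebra k ι →ₗ[k] FreeAlgebra k ι :=
  contract (coord k i) ∘ₗ comul q

/-- The counit axiom `(id ⊗ ε) Δ = id`. -/
theorem contract_counit_comul (x : FreeAlgebra k ι) :
    contract (counit k ι).toLinearMap (comul q x) = x := by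
  have key (u : FreeAlgebra k ι) : ∀ X, contract (counit k ι).toLinearMap (mulComul q u X) =
      u * contract (counit k ι).toLinearMap X := by
    induction u with
    | grade0 r =>
      intro X
      rw [AlgHom.commutes, ← Algebra.smul_def]
      exact map_smul _ r X
    | grade1 j =>
      intro X
      rw [mulComul_ι]
      induction X with
      | zero => simp
      | tmul a b =>
        have : counit k ι (FreeAlgebra.ι k j) = 0 := FreeAlgebra.lift_ι_apply _ _
        rw [mulPrimitive_tmul, map_add, contract_tmul, contract_tmul, contract_tmul]
        simp [this]
      | add X Y hX hY => simp only [map_add, hX, hY, mul_add]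
    | mul u v hu hv => intro X; rw [map_mul, mul_assoc, ← hv, ← hu]; rfl
    | add u v hu hv => intro X; rw [add_mul, ← hu, ← hv, ← map_add, map_add (mulComul q)]; rfl
  have := key x (comul q 1)
  rw [← comul_mul, mul_one, comul_one, contract_tmul] at this
  simpa using this

open Classical in
theorem skewDer_ι_mul (i j : ι) (x : FreeAlgebra k ι) : skewDer q i (FreeAlgebra.ι k j * x) =
    FreeAlgebra.ι k j * skewDer q i x + if j = i then act q i x else 0 := by
  have key (X : FreeAlgebra k ι ⊗[k] FreeAlgebra k ι) :
      contract (coord k i) (mulPrimitive q j X) = FreeAlgebra.ι k j * contract (coord k i) X +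
        if j = i then act q i (contract (counit k ι).toLinearMap X) else 0 := by
    induction X with
    | zero => simp
    | tmul a b =>
      rw [mulPrimitive_tmul, map_add, contract_tmul, contract_tmul, contract_tmul, contract_tmul,
        coord_ι_mul]
      split_ifs with h
      · subst h; simp
      · simp
    | add X Y hX hY =>
      simp only [map_add, hX, hY, mul_add]
      split_ifs <;> abel
  change contract (coord k i) (comul q _) = _
  rw [comul_mul, mulComul_ι, key, contract_counit_comul]
  rfl

theorem skewDer_one (i : ι) : skewDer q i (1 : FreeAlgebra k ι) = 0 := by
  change contract (coord k i) (comul q 1) = _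
  rw [comul_one, contract_tmul, coord_one, zero_smul]

theorem skewDer_ι_self (i : ι) : skewDer q i (FreeAlgebra.ι k i) = 1 := by
  have := skewDer_ι_mul q i i 1
  simpa [skewDer_one] using this

theorem skewDer_ι_of_ne {i j : ι} (h : j ≠ i) : skewDer q i (FreeAlgebra.ι k j) = 0 := by
  have := skewDer_ι_mul q i j 1
  simpa [skewDer_one, h] using this

/-- The skew Leibniz rule. -/
theorem skewDer_mul (i : ι) (u v : FreeAlgebra k ι) :
    skewDer q i (u * v) = u * skewDer q i v + skewDer q i u * act q i v := by
  induction u generalizing v with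
  | grade0 r =>
    rw [← Algebra.smul_def, map_smul, Algebra.smul_def, Algebra.algebraMap_eq_smul_one, map_smul,
      skewDer_one]
    simp
  | grade1 j =>
    rw [skewDer_ι_mul]
    split_ifs with h
    · subst h; rw [skewDer_ι_self, one_mul]
    · rw [skewDer_ι_of_ne q h, zero_mul]
  | mul u w hu hw => rw [mul_assoc, hu, hw, hu w, map_mul]; noncomm_ring
  | add u w hu hw => rw [add_mul, map_add, hu, hw, map_add]; noncomm_ring

/-- The skew derivations descend to the Nichols algebra: `x_i^*` vanishes on a graded coideal `I`,
so `id ⊗ x_i^*` maps `I ⊗ T(V) + T(V) ⊗ I` to `I`. -/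
theorem skewDer_mem_nicholsIdeal (i : ι) {x : FreeAlgebra k ι} (hx : x ∈ nicholsIdeal q) :
    skewDer q i x ∈ nicholsIdeal q := by
  refine (iSup₂_le (a := (toSubspace (nicholsIdeal q)).comap (skewDer q i)) fun I hI x hx => ?_ :
    (⨆ I ∈ {I | IsGradedCoideal q I}, toSubspace I) ≤ _) (mem_iSup_of_mem_nicholsIdeal q hx)
  change skewDer q i x ∈ nicholsIdeal q
  suffices h : skewDer q i x ∈ I from (show I ≤ nicholsIdeal q from le_sSup hI) h
  have hcoord : ∀ b ∈ toSubspace I, coord k i b = 0 := fun b hb => by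
    rw [hI.homogeneous] at hb
    exact (iSup₂_le (a := LinearMap.ker (coord k i)) fun n hn x hx =>
      coord_eq_zero hn i hx.2 : (⨆ n ∈ Set.Ici 2, toSubspace I ⊓ degreePart k ι n) ≤ _) hb
  refine coidealSubspace_le (S := toSubspace I)
    (M := (toSubspace I).comap (contract (coord k i))) (fun a ha b => ?_) (fun b hb a => ?_)
    (hI.coideal x hx)
  · rw [Submodule.mem_comap, contract_tmul]
    exact Submodule.smul_mem _ _ ha
  · rw [Submodule.mem_comap, contract_tmul, hcoord b hb, zero_smul]
    exact Submodule.zero_mem _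

end Derivations

/-! ### The elements `y_m` of the tensor algebra -/

section LiftY

variable {k : Type*} [Field k] (q : Fin 2 → Fin 2 → k)

/-- The lift `(ad_c x_1)^m (x_2)` of `y_m` to `T(V)`. -/
def liftY (m : ℕ) : FreeAlgebra k (Fin 2) := (adc q 0 ^ m) (FreeAlgebra.ι k 1)

theorem liftY_zero : liftY q 0 = FreeAlgebra.ι k 1 := rfl

theorem adc_apply (i : Fin 2) (z : FreeAlgebra k (Fin 2)) :
    adc q i z = FreeAlgebra.ι k i * z - act q i z * FreeAlgebra.ι k i := rfl

theorem act_liftY (i : Fin 2) (m : ℕ) :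
    act q i (liftY q m) = (q i 0 ^ m * q i 1) • liftY q m := by
  induction m generalizing i with
  | zero => simp [liftY_zero, act_ι]
  | succ m ih =>
    rw [liftY, pow_succ', Module.End.mul_apply, adc_apply]
    change act q i (_ * liftY q m - act q 0 (liftY q m) * _) =
      _ • (_ * liftY q m - act q 0 (liftY q m) * _)
    rw [ih 0, map_sub, map_mul, smul_mul_assoc, map_smul, map_mul, ih i, act_ι]
    simp only [smul_mul_assoc, mul_smul_comm, smul_smul, smul_sub]
    congr 2 <;> ring

theorem liftY_succ (m : ℕ) : liftY q (m + 1) = FreeAlgebra.ι k 0 * liftY q m -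
    (q 0 0 ^ m * q 0 1) • (liftY q m * FreeAlgebra.ι k 0) := by
  rw [← smul_mul_assoc, ← act_liftY, ← adc_apply, liftY, pow_succ', Module.End.mul_apply]
  rfl

theorem liftY_mem_degreePart (m : ℕ) : liftY q m ∈ degreePart k (Fin 2) (m + 1) := by
  induction m with
  | zero => exact ι_mem_degreePart 1
  | succ m ih =>
    rw [liftY_succ]
    refine Submodule.sub_mem _ ?_ (Submodule.smul_mem _ _ ?_)
    · rw [show m + 1 + 1 = 1 + (m + 1) by omega]
      exact mul_mem_degreePart (ι_mem_degreePart 0) ih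
    · exact mul_mem_degreePart ih (ι_mem_degreePart 0)

theorem liftY_mem_nicholsIdeal_of_le {m n : ℕ} (hmn : m ≤ n) (hm : liftY q m ∈ nicholsIdeal q) :
    liftY q n ∈ nicholsIdeal q := by
  induction n, hmn using Nat.le_induction with
  | base => exact hm
  | succ n _ ih =>
    rw [liftY_succ]
    exact (nicholsIdeal q).sub_mem ((nicholsIdeal q).mul_mem_left _ _ ih)
      (smul_mem_twoSidedIdeal _ _ ((nicholsIdeal q).mul_mem_right _ _ ih))

/-- The action on `T(V)` of the group-like element of degree `m α_1 + α_2`. -/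
def actY (m : ℕ) : Module.End k (FreeAlgebra k (Fin 2)) :=
  (act q 0).toLinearMap ^ m * (act q 1).toLinearMap

theorem actY_succ (m : ℕ) (z : FreeAlgebra k (Fin 2)) :
    actY q (m + 1) z = act q 0 (actY q m z) := by
  rw [actY, pow_succ', mul_assoc, Module.End.mul_apply]
  rfl

theorem actY_act (m : ℕ) (z : FreeAlgebra k (Fin 2)) :
    actY q m (act q 0 z) = act q 0 (actY q m z) := by
  induction m with
  | zero =>
    have : (act q 1).comp (act q 0) = (act q 0).comp (act q 1) := by
      refine FreeAlgebra.hom_ext (funext fun j => ?_)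
      simp [act_ι, smul_smul, mul_comm]
    exact DFunLike.congr_fun this z
  | succ m ih => rw [actY_succ, ih, actY_succ]

theorem actY_ι_mul (m : ℕ) (z : FreeAlgebra k (Fin 2)) :
    actY q m (FreeAlgebra.ι k 0 * z) =
      (q 0 0 ^ m * q 1 0) • (FreeAlgebra.ι k 0 * actY q m z) := by
  induction m with
  | zero =>
    change act q 1 (FreeAlgebra.ι k 0 * z) = _ • (FreeAlgebra.ι k 0 * act q 1 z)
    rw [map_mul, act_ι]
    simp
  | succ m ih =>
    rw [actY_succ, ih, map_smul, map_mul, act_ι, actY_succ, smul_mul_assoc, smul_smul, pow_succ]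
    congr 1
    ring

/-- The coproduct of `(ad_c x_1)^m (x_2)`, as an operator of left multiplication. -/
theorem mulComul_liftY (m : ℕ) : mulComul q (liftY q m) =
    TensorProduct.map (LinearMap.mulLeft k (liftY q m)) LinearMap.id +
    ∑ ij ∈ antidiagonal m, coprodCoeff (q 0 0) (q 0 1 * q 1 0) ij.1 ij.2 •
      ((TensorProduct.map (LinearMap.mulLeft k (FreeAlgebra.ι k 0)) LinearMap.id :
        Module.End k (FreeAlgebra k (Fin 2) ⊗[k] FreeAlgebra k (Fin 2))) ^ ij.2 *
      TensorProduct.map (actY q ij.1) (LinearMap.mulLeft k (liftY q ij.1))) := by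
  refine skewComm_expansion
    (X := fun m => mulComul q (liftY q m))
    (Y := fun m => TensorProduct.map (LinearMap.mulLeft k (liftY q m)) LinearMap.id)
    (Z := fun m => TensorProduct.map (actY q m) (LinearMap.mulLeft k (liftY q m)))
    (P := TensorProduct.map (LinearMap.mulLeft k (FreeAlgebra.ι k 0)) LinearMap.id)
    (Q := TensorProduct.map (act q 0).toLinearMap (LinearMap.mulLeft k (FreeAlgebra.ι k 0)))
    ?_ ?_ ?_ ?_ ?_ ?_ ?_ m
  · refine TensorProduct.ext' fun s t => ?_
    simp [act_ι, TensorProduct.smul_tmul']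
  · exact mulComul_ι q 1
  · intro m
    have h : mulComul q (FreeAlgebra.ι k 0) =
        TensorProduct.map (LinearMap.mulLeft k (FreeAlgebra.ι k 0)) LinearMap.id +
        TensorProduct.map (act q 0).toLinearMap (LinearMap.mulLeft k (FreeAlgebra.ι k 0)) :=
      mulComul_ι q 0
    rw [liftY_succ, map_sub, map_smul, map_mul, map_mul, h]
  · intro m
    refine TensorProduct.ext' fun s t => ?_
    simp [liftY_succ, sub_mul, mul_assoc, TensorProduct.sub_tmul, TensorProduct.smul_tmul']
  · intro m
    refine TensorProduct.ext' fun s t => ?_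
    simp [act_liftY, TensorProduct.smul_tmul']
  · intro m
    refine TensorProduct.ext' fun s t => ?_
    simp [actY_ι_mul, TensorProduct.smul_tmul']
  · intro m
    refine TensorProduct.ext' fun s t => ?_
    simp [liftY_succ, actY_succ, actY_act, sub_mul, mul_assoc, TensorProduct.tmul_sub,
      TensorProduct.tmul_smul]

/-- If `q_11^(m-1) q_12 q_21 = 1`, all the mixed terms of the coproduct of `y_m` vanish. -/
theorem liftY_mem_nicholsIdeal_of_pow_mul_eq_one {m : ℕ} (hm : 0 < m)
    (h : q 0 0 ^ (m - 1) * (q 0 1 * q 1 0) = 1) : liftY q m ∈ nicholsIdeal q := by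
  obtain ⟨m, rfl⟩ := Nat.exists_eq_succ_of_ne_zero hm.ne'
  rw [Nat.succ_eq_add_one] at *
  refine mem_nicholsIdeal_of_primitive q (show 2 ≤ m + 1 + 1 by omega) (liftY_mem_degreePart q _)
    (c := fun i => q i 0 ^ (m + 1) * q i 1) (fun i => act_liftY q i _) (actY q (m + 1)) ?_
  rw [mulComul_liftY, Finset.Nat.sum_antidiagonal_succ', Finset.sum_eq_zero]
  · simp [coprodCoeff_zero_right]
  · rintro ⟨i, j⟩ hij
    rw [Finset.HasAntidiagonal.mem_antidiagonal] at hij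
    rw [coprodCoeff_eq_zero (Nat.succ_pos _), zero_smul]
    simpa only [show i + (j + 1) - 1 = m + 1 - 1 by simp only at hij; omega] using h

theorem ι_pow_mem_nicholsIdeal {m : ℕ} (hm : 2 ≤ m) (h0 : qInt (q 0 0) m = 0)
    (hlt : ∀ j, 0 < j → j < m → qInt (q 0 0) j ≠ 0) :
    (FreeAlgebra.ι k 0) ^ m ∈ nicholsIdeal q := by
  refine mem_nicholsIdeal_of_primitive q hm
    (Submodule.pow_mem_pow _ (Submodule.subset_span (Set.mem_range_self 0)) m)
    (c := fun i => q i 0 ^ m) (fun i => by rw [map_pow, act_ι, smul_pow])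
    ((act q 0).toLinearMap ^ m) ?_
  have hc : (TensorProduct.map (act q 0).toLinearMap (LinearMap.mulLeft k (FreeAlgebra.ι k 0)) :
      Module.End k (FreeAlgebra k (Fin 2) ⊗[k] FreeAlgebra k (Fin 2))) *
      TensorProduct.map (LinearMap.mulLeft k (FreeAlgebra.ι k 0)) LinearMap.id =
      q 0 0 • (TensorProduct.map (LinearMap.mulLeft k (FreeAlgebra.ι k 0)) LinearMap.id *
        TensorProduct.map (act q 0).toLinearMap (LinearMap.mulLeft k (FreeAlgebra.ι k 0))) := by
    refine TensorProduct.ext' fun s t => ?_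
    simp [act_ι, TensorProduct.smul_tmul']
  rw [map_pow, mulComul_ι]
  refine (add_pow_of_qComm_of_qInt_eq_zero
    (A := Module.End k (FreeAlgebra k (Fin 2) ⊗[k] FreeAlgebra k (Fin 2))) hc (by omega) h0
    hlt).trans ?_
  rw [TensorProduct.map_pow, TensorProduct.map_pow, LinearMap.pow_mulLeft]
  congr 2
  exact one_pow _

theorem liftY_mem_nicholsIdeal_of_qInt_eq_zero {m : ℕ} (hm : 0 < m) (h0 : qInt (q 0 0) m = 0) :
    liftY q m ∈ nicholsIdeal q := by
  classical
  have hex : ∃ j, 0 < j ∧ qInt (q 0 0) j = 0 := ⟨m, hm, h0⟩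
  obtain ⟨hj, hj0⟩ := Nat.find_spec hex
  have hjm := Nat.find_min' hex ⟨hm, h0⟩
  have hlt : ∀ i, 0 < i → i < Nat.find hex → qInt (q 0 0) i ≠ 0 := fun i hi hi' hi0 =>
    Nat.find_min hex hi' ⟨hi, hi0⟩
  generalize Nat.find hex = j at *
  refine liftY_mem_nicholsIdeal_of_le q hjm ?_
  have hj2 : 2 ≤ j := by
    by_contra hc
    obtain rfl : j = 1 := by omega
    rw [qInt_one] at hj0
    exact one_ne_zero hj0
  have hpow := ι_pow_mem_nicholsIdeal q hj2 hj0 hlt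
  -- Left and right multiplication by `x_1` commute up to `q_11`, so that the `j`-th power of their
  -- difference `ad_c x_1` has only two terms.
  set R : Module.End k (FreeAlgebra k (Fin 2)) :=
    -(LinearMap.mulRight k (FreeAlgebra.ι k 0) * (act q 0).toLinearMap) with hR
  have hc : R * LinearMap.mulLeft k (FreeAlgebra.ι k 0) =
      q 0 0 • (LinearMap.mulLeft k (FreeAlgebra.ι k 0) * R) := by
    ext z
    simp [hR, act_ι, mul_assoc]
  have hadc : adc q 0 = LinearMap.mulLeft k (FreeAlgebra.ι k 0) + R := by
    rw [hR, ← sub_eq_add_neg]; rfl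
  have hRpow (i : ℕ) (z : FreeAlgebra k (Fin 2)) :
      ∃ w, (R ^ i) z = w * FreeAlgebra.ι k 0 ^ i := by
    induction i with
    | zero => exact ⟨z, by simp⟩
    | succ i ih =>
      obtain ⟨w, hw⟩ := ih
      refine ⟨-(q 0 0 ^ i • act q 0 w), ?_⟩
      rw [pow_succ', Module.End.mul_apply, hw]
      simp [hR, act_ι, smul_pow, pow_succ, mul_assoc]
  obtain ⟨w, hw⟩ := hRpow j (FreeAlgebra.ι k 1)
  rw [liftY, hadc, add_pow_of_qComm_of_qInt_eq_zero hc hj hj0 hlt, LinearMap.add_apply, hw,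
    LinearMap.pow_mulLeft]
  exact (nicholsIdeal q).add_mem ((nicholsIdeal q).mul_mem_right _ _ hpow)
    ((nicholsIdeal q).mul_mem_left _ _ hpow)

end LiftY

/-! ### The skew derivation dual to `y_n` -/

section TopDer

variable {k : Type*} [Field k] (q : Fin 2 → Fin 2 → k)

theorem skewDer_zero_liftY (m : ℕ) : skewDer q 0 (liftY q m) = 0 := by
  induction m with
  | zero => exact skewDer_ι_of_ne q (by decide)
  | succ m ih =>
    rw [liftY_succ, map_sub, map_smul, skewDer_mul, skewDer_mul, ih, act_liftY, skewDer_ι_self]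
    simp

/-- `∏_{l < m} (1 - q_11^l q_12 q_21)`, the scalar with `∂_2 y_m = derCoeff q m • x_1^m`. -/
def derCoeff (m : ℕ) : k := ∏ l ∈ Finset.range m, (1 - q 0 0 ^ l * (q 0 1 * q 1 0))

theorem derCoeff_succ (m : ℕ) :
    derCoeff q (m + 1) = derCoeff q m * (1 - q 0 0 ^ m * (q 0 1 * q 1 0)) :=
  Finset.prod_range_succ _ _

theorem skewDer_one_liftY (m : ℕ) :
    skewDer q 1 (liftY q m) = derCoeff q m • FreeAlgebra.ι k 0 ^ m := by
  induction m with
  | zero => simp [derCoeff, liftY_zero, skewDer_ι_self]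
  | succ m ih =>
    rw [liftY_succ, map_sub, map_smul, skewDer_mul, skewDer_mul, ih,
      skewDer_ι_of_ne q (show (0 : Fin 2) ≠ 1 by decide), act_ι, derCoeff_succ]
    simp only [mul_smul_comm, smul_mul_assoc, mul_zero, zero_mul, add_zero, zero_add, smul_smul]
    rw [← pow_succ', ← pow_succ]
    module

/-- The quantum factorial at `q_11`. -/
def qFact (m : ℕ) : k := ∏ l ∈ Finset.range m, qInt (q 0 0) (l + 1)

theorem qFact_succ (m : ℕ) : qFact q (m + 1) = qFact q m * qInt (q 0 0) (m + 1) :=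
  Finset.prod_range_succ _ _

theorem skewDer_zero_pow (m : ℕ) : skewDer q 0 (FreeAlgebra.ι k 0 ^ (m + 1)) =
    qInt (q 0 0) (m + 1) • FreeAlgebra.ι k 0 ^ m := by
  induction m with
  | zero => simp [qInt_one, skewDer_ι_self]
  | succ m ih =>
    rw [pow_succ, skewDer_mul, ih, skewDer_ι_self, act_ι, qInt_succ' _ (m + 1)]
    simp only [mul_smul_comm, smul_mul_assoc, mul_one, smul_smul]
    rw [← pow_succ]
    module

theorem skewDer_zero_pow_pow (m : ℕ) :
    (skewDer q 0 ^ m) (FreeAlgebra.ι k 0 ^ m) = qFact q m • 1 := by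
  induction m with
  | zero => simp [qFact]
  | succ m ih =>
    rw [pow_succ (skewDer q 0), Module.End.mul_apply, skewDer_zero_pow, map_smul, ih, smul_smul,
      qFact_succ, mul_comm]

theorem skewDer_zero_pow_pow_succ (m : ℕ) :
    (skewDer q 0 ^ m) (FreeAlgebra.ι k 0 ^ (m + 1)) = qFact q (m + 1) • FreeAlgebra.ι k 0 := by
  induction m with
  | zero => simp [qFact, qInt_one]
  | succ m ih =>
    rw [pow_succ (skewDer q 0), Module.End.mul_apply, skewDer_zero_pow, map_smul, ih, smul_smul,
      qFact_succ q (m + 1), mul_comm]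

/-- `∂_1^n ∂_2`. On the kernel of `∂_1`, which contains all `y_m`, it is a skew derivation. -/
def topDer (n : ℕ) : Module.End k (FreeAlgebra k (Fin 2)) := skewDer q 0 ^ n * skewDer q 1

theorem topDer_mem_nicholsIdeal (n : ℕ) {x : FreeAlgebra k (Fin 2)} (hx : x ∈ nicholsIdeal q) :
    topDer q n x ∈ nicholsIdeal q := by
  have (m : ℕ) : ∀ x ∈ nicholsIdeal q, (skewDer q 0 ^ m) x ∈ nicholsIdeal q := by
    induction m with
    | zero => exact fun x hx => hx
    | succ m ih =>
      intro x hx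
      rw [pow_succ, Module.End.mul_apply]
      exact ih _ (skewDer_mem_nicholsIdeal q 0 hx)
  exact this n _ (skewDer_mem_nicholsIdeal q 1 hx)

theorem topDer_mul (n : ℕ) {u v : FreeAlgebra k (Fin 2)} {c0 c1 : k} (hu : skewDer q 0 u = 0)
    (hv : skewDer q 0 v = 0) (h0 : act q 0 v = c0 • v) (h1 : act q 1 v = c1 • v) :
    topDer q n (u * v) = u * topDer q n v + (c0 ^ n * c1) • (topDer q n u * v) := by
  have hl (m : ℕ) (w : FreeAlgebra k (Fin 2)) :
      (skewDer q 0 ^ m) (u * w) = u * (skewDer q 0 ^ m) w := by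
    induction m generalizing w with
    | zero => rfl
    | succ m ih =>
      rw [pow_succ, Module.End.mul_apply, skewDer_mul, hu, zero_mul, add_zero, ih]; rfl
  have hr (m : ℕ) (w : FreeAlgebra k (Fin 2)) :
      (skewDer q 0 ^ m) (w * v) = c0 ^ m • ((skewDer q 0 ^ m) w * v) := by
    induction m generalizing w with
    | zero => simp
    | succ m ih =>
      rw [pow_succ, Module.End.mul_apply, skewDer_mul, hv, mul_zero, zero_add, h0,
        mul_smul_comm, map_smul, ih, smul_smul, pow_succ, mul_comm c0]; rfl
  rw [topDer, Module.End.mul_apply, Module.End.mul_apply, Module.End.mul_apply, skewDer_mul, h1,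
    map_add, hl, mul_smul_comm, map_smul, hr, smul_smul, mul_comm c1]

theorem topDer_liftY (n : ℕ) : topDer q n (liftY q n) = (derCoeff q n * qFact q n) • 1 := by
  rw [topDer, Module.End.mul_apply, skewDer_one_liftY, map_smul, skewDer_zero_pow_pow, smul_smul]

theorem topDer_liftY_succ (n : ℕ) : topDer q n (liftY q (n + 1)) =
    (derCoeff q n * qFact q n) • (((1 - q 0 0 ^ n * (q 0 1 * q 1 0)) * qInt (q 0 0) (n + 1)) •
      FreeAlgebra.ι k 0) := by
  rw [topDer, Module.End.mul_apply, skewDer_one_liftY, map_smul, skewDer_zero_pow_pow_succ,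
    smul_smul, smul_smul, derCoeff_succ, qFact_succ]
  congr 1
  ring

theorem skewDer_zero_liftY_pow (m j : ℕ) : skewDer q 0 (liftY q m ^ j) = 0 := by
  induction j with
  | zero => exact skewDer_one q 0
  | succ j ih => rw [pow_succ, skewDer_mul, ih, skewDer_zero_liftY, mul_zero, zero_mul, add_zero]

theorem act_liftY_pow (i : Fin 2) (m j : ℕ) :
    act q i (liftY q m ^ j) = (q i 0 ^ m * q i 1) ^ j • liftY q m ^ j := by
  rw [map_pow, act_liftY, smul_pow]

theorem p_eq (n : ℕ) : p q n = (q 0 0 ^ n * q 0 1) ^ n * (q 1 0 ^ n * q 1 1) := by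
  rw [p, mul_pow, ← pow_mul, sq]
  ring

theorem topDer_liftY_pow (n j : ℕ) : topDer q n (liftY q n ^ j) =
    (derCoeff q n * qFact q n) • (qInt (p q n) j • liftY q n ^ (j - 1)) := by
  induction j with
  | zero =>
    have : topDer q n 1 = 0 := by rw [topDer, Module.End.mul_apply, skewDer_one, map_zero]
    simp [this, qInt_zero]
  | succ j ih =>
    rw [pow_succ', topDer_mul q n (skewDer_zero_liftY q n) (skewDer_zero_liftY_pow q n j)
      (act_liftY_pow q 0 n j) (act_liftY_pow q 1 n j), ih, topDer_liftY, Nat.add_sub_cancel,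
      ← pow_mul, mul_comm j n, pow_mul, ← mul_pow, ← p_eq, qInt_succ]
    rcases j with _ | j
    · simp [qInt_zero]
    · simp only [mul_smul_comm, smul_mul_assoc, one_mul, Nat.add_sub_cancel]
      rw [← pow_succ']
      module

/-- The last term arises from `D y_{n+1}`, a multiple of `x_1`: the letter `x_1` is left in place of
`y_{n+1}`. -/
theorem topDer_word (n i j : ℕ) : topDer q n (liftY q n ^ i * liftY q (n + 1) * liftY q n ^ j) =
    (derCoeff q n * qFact q n) •
      (qInt (p q n) j • (liftY q n ^ i * liftY q (n + 1) * liftY q n ^ (j - 1)) +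
      (qInt (p q n) i * (p q n * q 0 0 ^ n * q 1 0) * p q n ^ j) •
        (liftY q n ^ (i - 1) * liftY q (n + 1) * liftY q n ^ j) +
      (((1 - q 0 0 ^ n * (q 0 1 * q 1 0)) * qInt (q 0 0) (n + 1)) * p q n ^ j) •
        (liftY q n ^ i * FreeAlgebra.ι k 0 * liftY q n ^ j)) := by
  have hker : skewDer q 0 (liftY q (n + 1) * liftY q n ^ j) = 0 := by
    rw [skewDer_mul, skewDer_zero_liftY, skewDer_zero_liftY_pow, mul_zero, zero_mul, add_zero]
  have hact (l : Fin 2) : act q l (liftY q (n + 1) * liftY q n ^ j) =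
      ((q l 0 ^ (n + 1) * q l 1) * (q l 0 ^ n * q l 1) ^ j) •
        (liftY q (n + 1) * liftY q n ^ j) := by
    rw [map_mul, act_liftY, act_liftY_pow, smul_mul_assoc, mul_smul_comm, smul_smul]
  rw [mul_assoc, topDer_mul q n (skewDer_zero_liftY_pow q n i) hker (hact 0) (hact 1),
    topDer_mul q n (skewDer_zero_liftY q (n + 1)) (skewDer_zero_liftY_pow q n j)
      (act_liftY_pow q 0 n j) (act_liftY_pow q 1 n j), topDer_liftY_pow, topDer_liftY_pow,
    topDer_liftY_succ]
  have e1 : ((q 0 0 ^ n * q 0 1) ^ j) ^ n * (q 1 0 ^ n * q 1 1) ^ j = p q n ^ j := by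
    rw [← pow_mul, mul_comm j n, pow_mul, ← mul_pow, ← p_eq]
  have e2 : (q 0 0 ^ (n + 1) * q 0 1 * (q 0 0 ^ n * q 0 1) ^ j) ^ n *
      (q 1 0 ^ (n + 1) * q 1 1 * (q 1 0 ^ n * q 1 1) ^ j) =
      p q n * q 0 0 ^ n * q 1 0 * p q n ^ j := by
    rw [← e1, p_eq]
    ring
  rw [e1, e2]
  simp only [mul_smul_comm, smul_mul_assoc, mul_add, smul_add, smul_smul, mul_assoc]
  module

end TopDer

/-! ### The descent -/

section Descent

variable {k : Type*} [Field k] (q : Fin 2 → Fin 2 → k)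

theorem proj_eq_zero_iff (x : FreeAlgebra k (Fin 2)) : proj q x = 0 ↔ x ∈ nicholsIdeal q := by
  rw [TwoSidedIdeal.mem_iff, ← map_zero (proj q)]
  exact RingCon.eq _

/-- The equality rests on `Q^(r + 1 + t) = 1` and `(r + 1)_Q = -Q^(r + 1) (t)_Q` for `Q = p_n`. -/
theorem descent_scalar_eq_mul_d {n N r t : ℕ} (hp : IsPrimitiveRoot (p q n) N) (ht : 1 ≤ t)
    (hN : r + 1 + t = N) :
    qInt (p q n) (r + 1) * (1 - q 0 0 ^ (2 * n) * (q 0 1 * q 1 0) / p q n ^ r) -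
      (1 - q 0 0 ^ n * (q 0 1 * q 1 0)) * qInt (q 0 0) (n + 1) =
    qInt (p q n) (r + 1) * d q n t := by
  have hp0 : p q n ≠ 0 := hp.ne_zero (by omega)
  have hz : qInt (p q n) N = 0 := qInt_eq_zero_of_isPrimitiveRoot hp (by omega)
  have ht0 : qInt (p q n) t ≠ 0 := qInt_ne_zero_of_isPrimitiveRoot hp (by omega) (by omega)
  rw [← hN, qInt_add] at hz
  have h1 : p q n ^ (r + 1) * p q n ^ t = 1 := by rw [← pow_add, hN, hp.pow_eq_one]
  have hr : (1 : k) / p q n ^ r = p q n ^ (t + 1) := by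
    rw [div_eq_iff (pow_ne_zero _ hp0), ← h1]
    ring
  rw [d, div_eq_mul_one_div _ (p q n ^ r), hr]
  field_simp
  linear_combination (-(1 - q 0 0 ^ n * (q 0 1 * q 1 0)) * qInt (q 0 0) (n + 1)) *
    (p q n ^ t * hz - qInt (p q n) t * h1)

/-- The scalar of the first descent step, which does not involve `p_n`. -/
theorem descent_scalar_zero {n : ℕ} (hn : 0 < n) :
    1 - q 0 0 ^ (2 * n) * (q 0 1 * q 1 0) -
      (1 - q 0 0 ^ n * (q 0 1 * q 1 0)) * qInt (q 0 0) (n + 1) =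
    -(q 0 0 * qInt (q 0 0) n * (1 - q 0 0 ^ (n - 1) * (q 0 1 * q 1 0))) := by
  obtain ⟨n, rfl⟩ := Nat.exists_eq_succ_of_ne_zero hn.ne'
  rw [Nat.succ_eq_add_one, Nat.add_sub_cancel]
  have h1 := qInt_succ' (q 0 0) (n + 1)
  have h2 := qInt_mul_sub_one (q 0 0) (n + 1)
  rw [h1]
  linear_combination (q 0 0 ^ (n + 1) * (q 0 1 * q 1 0)) * h2

end Descent

end NicholsDiag

end

theorem proposition4 {k : Type*} [Field k] [IsAlgClosed k] [CharZero k]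
    (q : Fin 2 → Fin 2 → k) (hq : ∀ i j, q i j ≠ 0) (hdiag : ∀ i, q i i ≠ 1)
    (n : ℕ) (hn : 0 < n) (N : ℕ) (hN : 2 ≤ N) (hp : IsPrimitiveRoot (NicholsDiag.p q n) N)
    (hpow : NicholsDiag.y q n ^ N = 0) (hne : NicholsDiag.y q (n + 1) ≠ 0) :
    ∃ t : ℕ, 1 ≤ t ∧ t ≤ N - 2 ∧ NicholsDiag.d q n t = 0 := by
  open NicholsDiag in
  have hY : liftY q n ^ N ∈ nicholsIdeal q := by
    rw [← proj_eq_zero_iff, map_pow]; exact hpow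
  have hZ : liftY q (n + 1) ∉ nicholsIdeal q := fun h => hne ((proj_eq_zero_iff q _).2 h)
  by_contra! hd
  have hint : ∀ m, 0 < m → m ≤ n → qInt (q 0 0) m ≠ 0 := fun m hm hmn h0 =>
    hZ (liftY_mem_nicholsIdeal_of_le q (by omega) (liftY_mem_nicholsIdeal_of_qInt_eq_zero q hm h0))
  have hbr : ∀ l, l < n → 1 - q 0 0 ^ l * (q 0 1 * q 1 0) ≠ 0 := fun l hl h0 =>
    hZ (liftY_mem_nicholsIdeal_of_le q (show l + 1 ≤ n + 1 by omega)
      (liftY_mem_nicholsIdeal_of_pow_mul_eq_one q (Nat.succ_pos l) (sub_eq_zero.1 h0).symm))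
  have hγ : derCoeff q n * qFact q n ≠ 0 :=
    mul_ne_zero (Finset.prod_ne_zero_iff.2 fun l hl => hbr l (Finset.mem_range.1 hl))
      (Finset.prod_ne_zero_iff.2 fun l hl => hint _ l.succ_pos (Finset.mem_range.1 hl))
  have hcomm : FreeAlgebra.ι k 0 * liftY q n =
      (q 0 0 ^ n * q 0 1) • (liftY q n * FreeAlgebra.ι k 0) + liftY q (n + 1) := by
    rw [liftY_succ]; abel
  -- `W_r ∈ J` for all `r`, by applying `D` repeatedly; the last one is `W_{N-1} = y_{n+1}`.
  have main : ∀ r m, r + m + 1 = N →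
      markedSum (p q n) (q 0 0 ^ n * q 0 1) (liftY q n) (liftY q (n + 1)) r m ∈
        nicholsIdeal q := by
    intro r
    induction r with
    | zero =>
      intro m hm
      have h := mul_pow_eq_markedSum (p q n) _ hcomm m
      rw [show m + 1 = N by omega] at h
      rw [← sub_eq_iff_eq_add'.2 h]
      exact (nicholsIdeal q).sub_mem ((nicholsIdeal q).mul_mem_left _ _ hY)
        (smul_mem_twoSidedIdeal _ _ ((nicholsIdeal q).mul_mem_right _ _ hY))
    | succ r ih =>
      intro m hm
      have h := topDer_mem_nicholsIdeal q n (ih (m + 1) (by omega))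
      have hp' : IsPrimitiveRoot (p q n) (r + m + 2) := by
        rwa [show r + m + 2 = N by omega]
      rw [map_markedSum (topDer q n) hcomm (topDer_word q n)
        (e := q 0 0 ^ (2 * n) * (q 0 1 * q 1 0)) (by ring) hp'] at h
      refine (mem_toSubspace.1 (((toSubspace (nicholsIdeal q)).smul_mem_iff
        (mul_ne_zero hγ ?_)).1 h))
      rcases Nat.eq_zero_or_pos r with rfl | hr
      · rw [qInt_one, pow_zero, div_one, one_mul, descent_scalar_zero q hn]
        exact neg_ne_zero.2 (mul_ne_zero (mul_ne_zero (hq 0 0) (hint n hn le_rfl))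
          (hbr (n - 1) (by omega)))
      · rw [descent_scalar_eq_mul_d q hp (t := m + 1) (by omega) (by omega)]
        exact mul_ne_zero (qInt_ne_zero_of_isPrimitiveRoot hp (by omega) (by omega))
          (hd _ (by omega) (by omega))
  have := main (N - 1) 0 (by omega)
  rw [markedSum_zero_right] at this
  exact hZ this
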